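/- Let $G$ be a finitely generated (hence countable) group and let $\mu$ be a probability measure on $G$ whose support generates $G$ as a semigroup. Assume that $\mu$ is symmetric, i.e. $\mu(s^{-1})=\mu(s)$ for all $s\in G$. Put $\mu^{*0}=\delta_e$ and let $\mu^{*n}$ denote the $n$-fold convolution power of $\mu$, i.e. $\mu^{*n}(s)=\sum_{s_1\cdots s_n=s}\mu(s_1)\cdots\mu(s_n)$ for $n\ge 1$. Let $\rho$ be a word-norm on $G$: there is a finite generating set $S=S^{-1}$ of $G$ such that $\rho(g)=\min\{n\ge 0 : g\in S^n\}$ for all $g\in G$, where $S^0=\{e\}$. Suppose that $\rho$ is $\mu$-integrable, i.e. $\sum_{s}\rho(s)\mu(s)<\infty$. Then the limit $$\ell_\rho(\mu)=\lim_{n\to\infty}\frac1n\sum_{s\in G}\rho(s)\,\mu^{*n}(s)$$ (the drift) exists and is finite, and the following are equivalent: 1. $(G,\mu)$ is Liouville, i.e. every bounded function $u:G\to\mathbb{R}$ satisfying $\sum_{s\in G}u(gs)\mu(s)=u(g)$ for all $g\in G$ is constant; 2. $\ell_\rho(\mu)=0$. -/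

import Mathlib

open scoped Pointwise ENNReal NNReal Topology

namespace MeasuredGroup

/-- The pair `(G, μ)` is a measured group: `G` is a countable group and the support of the
probability measure `μ` generates `G` as a semigroup. -/
structure IsMeasuredGroup {G : Type*} [Group G] (μ : PMF G) : Prop where
  countable : Countable G
  generates : Subsemigroup.closure μ.support = ⊤

/-- `μ` coincides with its adjoint `s ↦ μ(s⁻¹)`. -/
def IsSymmetric {G : Type*} [Group G] (μ : PMF G) : Prop :=
  ∀ s : G, μ s⁻¹ = μ s

/-- Convolution of probability measures: the law of `s * t` for independent `s ∼ μ`, `t ∼ ν`. -/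
noncomputable def conv {G : Type*} [Group G] (μ ν : PMF G) : PMF G :=
  μ.bind fun s => ν.map fun t => s * t

/-- The convolution powers `μ^{*n}`, with `μ^{*0} = δ_e`. -/
noncomputable def convPow {G : Type*} [Group G] (μ : PMF G) : ℕ → PMF G
  | 0 => PMF.pure 1
  | n + 1 => conv (convPow μ n) μ

/-- `u` is `μ`-harmonic: `∑ₛ u(gs) μ(s)` converges, with sum `u(g)`, for every `g`. -/
def IsHarmonic {G : Type*} [Group G] (μ : PMF G) (u : G → ℝ) : Prop :=
  ∀ g : G, HasSum (fun s : G => u (g * s) * (μ s).toReal) (u g)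

/-- All bounded `μ`-harmonic functions are constant. -/
def IsLiouville {G : Type*} [Group G] (μ : PMF G) : Prop :=
  ∀ u : G → ℝ, (∃ C : ℝ, ∀ g, |u g| ≤ C) → IsHarmonic μ u → ∃ c : ℝ, ∀ g, u g = c

/-- The word-norm of `g` associated to `S`: the least `n ≥ 0` such that `g` is a product of `n`
elements of `S` (`S ^ n` is the pointwise product, `S ^ 0 = {e}`). -/
noncomputable def wordNorm {G : Type*} [Group G] (S : Set G) (g : G) : ℕ :=
  sInf {n : ℕ | g ∈ S ^ n}

/-- `ρ` is the word-norm associated to some finite symmetric generating set of `G`. -/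
def IsWordNorm {G : Type*} [Group G] (ρ : G → ℝ≥0) : Prop :=
  ∃ S : Set G, S.Finite ∧ S⁻¹ = S ∧ Subgroup.closure S = ⊤ ∧ ∀ g, ρ g = wordNorm S g

/-- The sum `∑ₛ ρ(s) μ(s)`, as an element of `[0, ∞]`. -/
noncomputable def mean {G : Type*} (μ : PMF G) (ρ : G → ℝ≥0) : ℝ≥0∞ :=
  ∑' s : G, (ρ s : ℝ≥0∞) * μ s

/-- `ρ` is `μ`-integrable. -/
def IsIntegrable {G : Type*} (μ : PMF G) (ρ : G → ℝ≥0) : Prop :=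
  mean μ ρ < ∞

/-- The sequence `(1/n) ∑ₛ ρ(s) μ^{*n}(s)` whose limit is the drift. -/
noncomputable def driftSeq {G : Type*} [Group G] (μ : PMF G) (ρ : G → ℝ≥0) (n : ℕ) : ℝ≥0∞ :=
  mean (convPow μ n) ρ / (n : ℝ≥0∞)

/-- The drift `ℓ_ρ(μ) = lim (1/n) ∑ₛ ρ(s) μ^{*n}(s)`, as an element of `[0, ∞]`. -/
noncomputable def drift {G : Type*} [Group G] (μ : PMF G) (ρ : G → ℝ≥0) : ℝ≥0∞ :=
  Filter.limUnder Filter.atTop (driftSeq μ ρ)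

end MeasuredGroup

/-! The drift exists by Fekete's lemma, since the mean length of the random walk is subadditive in
time. Zero drift implies Liouville through entropy. Gibbs' inequality against the weight `exp (-c
ρ)` bounds the entropy of `μ^{*n}` by `c` times the mean length plus a constant (`entropy_le`), so
it grows sublinearly. For each `s` in the support, the entropy gained at step `n + 1` is at least `μ
s` times the squared Hellinger distance between `μ^{*n}` and a translate by `s` of `μ^{*(n+1)}`
(`entropy_add_le_entropy_conv`). Some such distance is therefore arbitrarily small, so bounded
harmonic functions do not see right multiplication by `s`. Conversely, Cesàro averaging `ρ (g⁻¹ x) -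
ρ x` along the walk, with an ultrafilter limit, gives a function `busemann` of `g`. The Liouville
property makes the averaging left-invariant, hence `busemann` a homomorphism to `ℝ`. Its
`μ`-integral is the drift by telescoping, and vanishes because `μ` is symmetric. -/

namespace MeasuredGroup

/-! ### Convolution algebra. -/

section Convolution

variable {G : Type*} [Group G]

theorem conv_apply (μ ν : PMF G) (x : G) : conv μ ν x = ∑' s, μ s * ν (s⁻¹ * x) := by
  classical
  rw [conv, PMF.bind_apply]
  refine tsum_congr fun s => ?_
  rw [PMF.map_apply, tsum_eq_single (s⁻¹ * x)]
  · simp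
  · intro t ht
    rw [if_neg]
    rintro rfl
    simp at ht

theorem tsum_mul_conv (μ ν : PMF G) (f : G → ℝ≥0∞) :
    ∑' x, f x * conv μ ν x = ∑' s, μ s * ∑' t, f (s * t) * ν t := by
  simp_rw [conv_apply, ← ENNReal.tsum_mul_left]
  rw [ENNReal.tsum_comm]
  refine tsum_congr fun s => ?_
  rw [← (Equiv.mulLeft s).tsum_eq]
  refine tsum_congr fun t => ?_
  simp only [Equiv.coe_mulLeft, inv_mul_cancel_left]
  ring

theorem conv_assoc (μ ν ξ : PMF G) : conv (conv μ ν) ξ = conv μ (conv ν ξ) := by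
  simp only [conv, PMF.bind_bind, PMF.map_bind, PMF.bind_map, PMF.map_comp]
  congr 1; ext1 s; congr 1; ext1 t
  simp [Function.comp_def, mul_assoc]

theorem conv_pure_one (μ : PMF G) : conv μ (PMF.pure 1) = μ := by
  simp [conv, PMF.pure_map]

theorem pure_one_conv (μ : PMF G) : conv (PMF.pure 1) μ = μ := by
  simp only [conv, PMF.pure_bind, one_mul]
  exact PMF.map_id μ

theorem convPow_add (μ : PMF G) (m n : ℕ) :
    convPow μ (m + n) = conv (convPow μ m) (convPow μ n) := by
  induction n with
  | zero => simp [convPow, conv_pure_one]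
  | succ n ih => rw [← add_assoc, convPow, ih, conv_assoc, convPow]

theorem convPow_one (μ : PMF G) : convPow μ 1 = μ := by
  simp [convPow, pure_one_conv]

theorem convPow_succ_left (μ : PMF G) (n : ℕ) :
    convPow μ (n + 1) = conv μ (convPow μ n) := by
  rw [add_comm, convPow_add, convPow_one]

end Convolution

/-! ### Real expectations and Fubini for convolutions. -/

section Expectation

variable {G : Type*}

theorem hasSum_toReal (μ : PMF G) : HasSum (fun x => (μ x).toReal) 1 := by
  have h := ENNReal.hasSum_toReal (f := μ) (by simp)
  rwa [← ENNReal.tsum_toReal_eq μ.apply_ne_top, μ.tsum_coe, ENNReal.toReal_one] at h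

/-- The expectation of a real function on `G`. -/
noncomputable def expect (μ : PMF G) (f : G → ℝ) : ℝ :=
  ∑' x, f x * (μ x).toReal

theorem summable_of_bounded (μ : PMF G) {f : G → ℝ} {C : ℝ} (hf : ∀ x, |f x| ≤ C) :
    Summable fun x => f x * (μ x).toReal := by
  refine Summable.of_norm_bounded ((hasSum_toReal μ).summable.mul_left C) fun x => ?_
  rw [norm_mul, Real.norm_eq_abs, Real.norm_of_nonneg ENNReal.toReal_nonneg]
  exact mul_le_mul_of_nonneg_right (hf x) ENNReal.toReal_nonneg

theorem abs_expect_le (μ : PMF G) {f : G → ℝ} {C : ℝ} (hf : ∀ x, |f x| ≤ C) :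
    |expect μ f| ≤ C := by
  have h := tsum_of_norm_bounded ((hasSum_toReal μ).mul_left C)
    (f := fun x => f x * (μ x).toReal) fun x => by
      rw [norm_mul, Real.norm_eq_abs, Real.norm_of_nonneg ENNReal.toReal_nonneg]
      exact mul_le_mul_of_nonneg_right (hf x) ENNReal.toReal_nonneg
  simpa [expect] using h

theorem expect_add (μ : PMF G) {f g : G → ℝ} (hf : Summable fun x => f x * (μ x).toReal)
    (hg : Summable fun x => g x * (μ x).toReal) :
    expect μ (fun x => f x + g x) = expect μ f + expect μ g := by
  simp only [expect, add_mul]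
  exact hf.tsum_add hg

theorem expect_sub (μ : PMF G) {f g : G → ℝ} (hf : Summable fun x => f x * (μ x).toReal)
    (hg : Summable fun x => g x * (μ x).toReal) :
    expect μ (fun x => f x - g x) = expect μ f - expect μ g := by
  simp only [expect, sub_mul]
  exact hf.tsum_sub hg

theorem hasSum_expect_conv [Group G] (μ ν : PMF G) {f : G → ℝ}
    (hf : Summable fun x => f x * (conv μ ν x).toReal) :
    HasSum (fun s => expect ν (fun t => f (s * t)) * (μ s).toReal) (expect (conv μ ν) f) := by
  have hx (x : G) : HasSum (fun s => (μ s).toReal * (ν (s⁻¹ * x)).toReal)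
      (conv μ ν x).toReal := by
    have h := ENNReal.hasSum_toReal (f := fun s => μ s * ν (s⁻¹ * x))
      (by rw [← conv_apply]; exact PMF.apply_ne_top _ _)
    rw [← ENNReal.tsum_toReal_eq fun s => ENNReal.mul_ne_top (PMF.apply_ne_top _ _)
      (PMF.apply_ne_top _ _), ← conv_apply] at h
    simpa only [ENNReal.toReal_mul] using h
  let F : G × G → ℝ := fun p => f p.1 * ((μ p.2).toReal * (ν (p.2⁻¹ * p.1)).toReal)
  have hF : Summable F := by
    rw [← summable_norm_iff, summable_prod_of_nonneg fun _ => norm_nonneg _]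
    have hn (x s : G) : ‖F (x, s)‖ = |f x| * ((μ s).toReal * (ν (s⁻¹ * x)).toReal) := by
      simp [F]
    simp only [hn]
    refine ⟨fun x => (hx x).summable.mul_left _, ?_⟩
    simp only [((hx _).mul_left _).tsum_eq]
    simpa [abs_mul] using hf.abs
  have h1 : HasSum F (expect (conv μ ν) f) := by
    have := hF.hasSum
    rwa [hF.tsum_prod, tsum_congr fun x => ((hx x).mul_left (f x)).tsum_eq] at this
  have h2 : HasSum (fun p : G × G => f (p.1 * p.2) * ((μ p.1).toReal * (ν p.2).toReal))
      (expect (conv μ ν) f) := by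
    let e : G × G ≃ G × G :=
      { toFun := fun p => (p.1 * p.2, p.1)
        invFun := fun p => (p.2, p.2⁻¹ * p.1)
        left_inv := fun p => by simp
        right_inv := fun p => by simp }
    have := e.hasSum_iff.2 h1
    simpa [Function.comp_def, F, e] using this
  have h3 := h2.prod_fiberwise fun s => (h2.summable.prod_factor s).hasSum
  convert h3 using 2 with s
  rw [expect, ← tsum_mul_right]
  exact tsum_congr fun t => by ring

theorem hasSum_mean {ν : PMF G} {ρ : G → ℝ≥0} (h : mean ν ρ ≠ ∞) :
    HasSum (fun x => (ρ x : ℝ) * (ν x).toReal) (mean ν ρ).toReal := by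
  have h1 := ENNReal.hasSum_toReal (f := fun x => (ρ x : ℝ≥0∞) * ν x) h
  rw [← ENNReal.tsum_toReal_eq fun s => ENNReal.mul_ne_top ENNReal.coe_ne_top
    (PMF.apply_ne_top _ _)] at h1
  simp only [ENNReal.toReal_mul, ENNReal.coe_toReal] at h1
  exact h1

theorem expect_eq_mean {ν : PMF G} {ρ : G → ℝ≥0} (h : mean ν ρ ≠ ∞) :
    expect ν (fun x => (ρ x : ℝ)) = (mean ν ρ).toReal :=
  (hasSum_mean h).tsum_eq

end Expectation

/-! ### Word norms and exponential growth. -/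

section WordNorm

variable {G : Type*} [Group G] {S : Set G}

theorem exists_mem_pow_of_closure_eq_top (hS : S⁻¹ = S) (hgen : Subgroup.closure S = ⊤) (g : G) :
    ∃ n : ℕ, g ∈ S ^ n := by
  have hg : g ∈ Subgroup.closure S := hgen ▸ Subgroup.mem_top g
  induction hg using Subgroup.closure_induction with
  | mem x hx => exact ⟨1, by simpa using hx⟩
  | one => exact ⟨0, by simp⟩
  | mul x y _ _ hx hy =>
    obtain ⟨m, hm⟩ := hx
    obtain ⟨n, hn⟩ := hy
    exact ⟨m + n, pow_add S m n ▸ Set.mul_mem_mul hm hn⟩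
  | inv x _ hx =>
    obtain ⟨n, hn⟩ := hx
    refine ⟨n, ?_⟩
    rw [← hS, inv_pow]
    simpa using hn

theorem mem_pow_wordNorm (hS : S⁻¹ = S) (hgen : Subgroup.closure S = ⊤) (g : G) :
    g ∈ S ^ wordNorm S g :=
  Nat.sInf_mem (s := {n : ℕ | g ∈ S ^ n}) (exists_mem_pow_of_closure_eq_top hS hgen g)

theorem wordNorm_le {g : G} {n : ℕ} (h : g ∈ S ^ n) : wordNorm S g ≤ n :=
  Nat.sInf_le h

theorem wordNorm_one : wordNorm S 1 = 0 :=
  Nat.le_zero.1 (wordNorm_le (by simp))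

theorem wordNorm_mul_le (hS : S⁻¹ = S) (hgen : Subgroup.closure S = ⊤) (g h : G) :
    wordNorm S (g * h) ≤ wordNorm S g + wordNorm S h :=
  wordNorm_le (pow_add S _ _ ▸
    Set.mul_mem_mul (mem_pow_wordNorm hS hgen g) (mem_pow_wordNorm hS hgen h))

theorem wordNorm_inv_le (hS : S⁻¹ = S) (hgen : Subgroup.closure S = ⊤) (g : G) :
    wordNorm S g⁻¹ ≤ wordNorm S g := by
  have h : g⁻¹ ∈ (S⁻¹) ^ wordNorm S g := by
    rw [inv_pow]
    simpa using mem_pow_wordNorm hS hgen g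
  rw [hS] at h
  exact wordNorm_le h

/-- Since `|S ^ n| ≤ |S| ^ n`, the sum is dominated by a geometric series of ratio `k * exp (-k)`
with `k = |S|`, and `k < exp k` makes this less than `1`. -/
theorem tsum_exp_neg_card_mul_wordNorm_lt_top (hfin : S.Finite) (hS : S⁻¹ = S)
    (hgen : Subgroup.closure S = ⊤) :
    ∑' g, ENNReal.ofReal (Real.exp (-(S.ncard * wordNorm S g))) < ∞ := by
  classical
  obtain ⟨T, rfl⟩ := hfin.exists_finset_coe
  rw [Set.ncard_coe_finset]
  set r : ℝ := Real.exp (-(T.card : ℝ)) with hr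
  have hr0 : 0 < r := Real.exp_pos _
  have hr1 : T.card * r < 1 := by
    have h := Real.add_one_le_exp (T.card : ℝ)
    have h2 : Real.exp (T.card : ℝ) * r = 1 := by rw [hr, ← Real.exp_add]; simp
    nlinarith
  have key (g : G) : ENNReal.ofReal (Real.exp (-(T.card * wordNorm (T : Set G) g))) ≤
      ∑' n : ℕ, ∑ x ∈ T ^ n, if g = x then ENNReal.ofReal (r ^ n) else 0 := by
    refine le_trans ?_ (ENNReal.le_tsum (wordNorm (T : Set G) g))
    have hg : g ∈ T ^ wordNorm (T : Set G) g := by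
      rw [← Finset.mem_coe, Finset.coe_pow]
      exact mem_pow_wordNorm hS hgen g
    rw [Finset.sum_ite_eq, if_pos hg, hr, ← Real.exp_nat_mul]
    exact le_of_eq (by ring_nf)
  refine (ENNReal.tsum_le_tsum key).trans_lt ?_
  rw [ENNReal.tsum_comm]
  have h (n : ℕ) : ∑' g : G, ∑ x ∈ T ^ n, (if g = x then ENNReal.ofReal (r ^ n) else 0) ≤
      ENNReal.ofReal ((T.card * r) ^ n) := by
    rw [Summable.tsum_finsetSum fun _ _ => ENNReal.summable]
    simp only [tsum_ite_eq, Finset.sum_const, nsmul_eq_mul]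
    rw [mul_pow, ENNReal.ofReal_mul (by positivity)]
    gcongr
    rw [← Nat.cast_pow, ENNReal.ofReal_natCast]
    exact_mod_cast Finset.card_pow_le
  refine (ENNReal.tsum_le_tsum h).trans_lt ?_
  rw [← ENNReal.ofReal_tsum_of_nonneg (fun n => by positivity)
    (summable_geometric_of_lt_one (by positivity) hr1)]
  exact ENNReal.ofReal_lt_top

end WordNorm

/-! ### Existence and finiteness of the drift. -/

section Drift

variable {G : Type*} [Group G] {μ : PMF G} {ρ : G → ℝ≥0}

/-- A length function: subadditive, symmetric and vanishing at the identity. -/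
structure IsLength (ρ : G → ℝ≥0) : Prop where
  map_one : ρ 1 = 0
  map_mul_le : ∀ g h, ρ (g * h) ≤ ρ g + ρ h
  map_inv : ∀ g, ρ g⁻¹ = ρ g

theorem IsWordNorm.isLength (hρ : IsWordNorm ρ) : IsLength ρ := by
  obtain ⟨S, -, hS, hgen, h⟩ := hρ
  refine ⟨by simp [h, wordNorm_one], fun a b => ?_, fun a => ?_⟩
  · rw [h, h, h]
    exact_mod_cast wordNorm_mul_le hS hgen a b
  · rw [h, h]
    have h1 := wordNorm_inv_le hS hgen a
    have h2 := wordNorm_inv_le hS hgen a⁻¹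
    rw [inv_inv] at h2
    rw [le_antisymm h1 h2]

/-- Bounded in `x` although `ρ` need not be, so `ultraMean` applies; the bound is `μ`-integrable in
`g`, which later permits dominated convergence. -/
theorem IsLength.abs_sub_le (hρ : IsLength ρ) (g x : G) :
    |(ρ (g⁻¹ * x) : ℝ) - ρ x| ≤ ρ g := by
  have h1 := hρ.map_mul_le g⁻¹ x
  have h2 := hρ.map_mul_le g (g⁻¹ * x)
  rw [hρ.map_inv] at h1
  rw [mul_inv_cancel_left] at h2
  rw [abs_sub_le_iff]
  have h1' : (ρ (g⁻¹ * x) : ℝ) ≤ ρ g + ρ x := by exact_mod_cast h1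
  have h2' : (ρ x : ℝ) ≤ ρ g + ρ (g⁻¹ * x) := by exact_mod_cast h2
  constructor <;> linarith

theorem mean_conv_le (hρ : IsLength ρ) (μ ν : PMF G) :
    mean (conv μ ν) ρ ≤ mean μ ρ + mean ν ρ := by
  rw [mean, tsum_mul_conv]
  calc ∑' s, μ s * ∑' t, (ρ (s * t) : ℝ≥0∞) * ν t
      ≤ ∑' s, μ s * ∑' t, ((ρ s : ℝ≥0∞) * ν t + ρ t * ν t) := by
        gcongr with s t
        rw [← add_mul]
        gcongr
        exact_mod_cast hρ.map_mul_le s t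
    _ = mean μ ρ + mean ν ρ := by
        simp_rw [ENNReal.tsum_add, ENNReal.tsum_mul_left, ν.tsum_coe, mul_one, mul_add,
          ENNReal.tsum_add, ENNReal.tsum_mul_right, μ.tsum_coe, one_mul, mean, mul_comm]

theorem mean_convPow_zero (hρ : IsLength ρ) : mean (convPow μ 0) ρ = 0 := by
  classical
  rw [mean, ENNReal.tsum_eq_zero]
  intro s
  by_cases h : s = 1 <;> simp [convPow, h, hρ.map_one]

theorem mean_convPow_ne_top (hρ : IsLength ρ) (hint : IsIntegrable μ ρ) (n : ℕ) :
    mean (convPow μ n) ρ ≠ ∞ := by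
  induction n with
  | zero => simp [mean_convPow_zero hρ]
  | succ n ih =>
    exact ((mean_conv_le hρ _ _).trans_lt (ENNReal.add_lt_top.2 ⟨ih.lt_top, hint⟩)).ne

theorem subadditive_mean_convPow (hρ : IsLength ρ) (hint : IsIntegrable μ ρ) :
    Subadditive fun n => (mean (convPow μ n) ρ).toReal := fun m n => by
  have hm := mean_convPow_ne_top hρ hint m
  have hn := mean_convPow_ne_top hρ hint n
  simp only [convPow_add]
  rw [← ENNReal.toReal_add hm hn]
  exact ENNReal.toReal_mono (ENNReal.add_ne_top.2 ⟨hm, hn⟩) (mean_conv_le hρ _ _)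

theorem exists_tendsto_driftSeq (hρ : IsLength ρ) (hint : IsIntegrable μ ρ) :
    ∃ l : ℝ≥0, Filter.Tendsto (driftSeq μ ρ) Filter.atTop (𝓝 l) := by
  have hsub := subadditive_mean_convPow hρ hint
  have h := hsub.tendsto_lim ⟨0, by rintro _ ⟨n, rfl⟩; positivity⟩
  refine ⟨hsub.lim.toNNReal, ?_⟩
  refine (ENNReal.tendsto_ofReal h).congr' ?_
  filter_upwards [Filter.eventually_gt_atTop 0] with n hn
  rw [ENNReal.ofReal_div_of_pos (by exact_mod_cast hn),
    ENNReal.ofReal_toReal (mean_convPow_ne_top hρ hint n), ENNReal.ofReal_natCast, driftSeq]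

theorem tendsto_driftSeq (hρ : IsLength ρ) (hint : IsIntegrable μ ρ) :
    Filter.Tendsto (driftSeq μ ρ) Filter.atTop (𝓝 (drift μ ρ)) := by
  obtain ⟨l, hl⟩ := exists_tendsto_driftSeq hρ hint
  rwa [drift, hl.limUnder_eq]

theorem drift_lt_top (hρ : IsLength ρ) (hint : IsIntegrable μ ρ) : drift μ ρ < ∞ := by
  obtain ⟨l, hl⟩ := exists_tendsto_driftSeq hρ hint
  rw [drift, hl.limUnder_eq]
  exact ENNReal.coe_lt_top

theorem tendsto_mean_convPow_div (hρ : IsLength ρ) (hint : IsIntegrable μ ρ) :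
    Filter.Tendsto (fun n : ℕ => (mean (convPow μ n) ρ).toReal / n) Filter.atTop
      (𝓝 (drift μ ρ).toReal) := by
  refine ((ENNReal.tendsto_toReal (drift_lt_top hρ hint).ne).comp
    (tendsto_driftSeq hρ hint)).congr fun n => ?_
  simp [driftSeq]

end Drift

/-! ### Entropy, Hellinger distance and total variation. -/

section Entropy

variable {G : Type*}

/-- The Shannon entropy of `ν`, as an element of `[0, ∞]`. -/
noncomputable def entropy (ν : PMF G) : ℝ≥0∞ :=
  ∑' x, ENNReal.ofReal (-Real.log (ν x).toReal) * ν x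

/-- The square of the Hellinger distance between `a` and `b`. -/
noncomputable def hellingerSq (a b : G → ℝ≥0∞) : ℝ≥0∞ :=
  ∑' x, ENNReal.ofReal ((√(a x).toReal - √(b x).toReal) ^ 2)

/-- Pointwise Gibbs inequality with a remainder: `log t ≤ t - 1` is used at `t = √b / √a` rather
than `b / a`, which leaves the Hellinger term. -/
theorem mul_neg_log_add_le {a b : ℝ} (ha : 0 ≤ a) (hb : 0 ≤ b) (h : b = 0 → a = 0) :
    -Real.log a * a + a + (√a - √b) ^ 2 ≤ -Real.log b * a + b := by
  rcases ha.eq_or_lt with rfl | ha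
  · simp [Real.sq_sqrt hb]
  have hb' : 0 < b := hb.lt_of_ne fun h' => ha.ne' (h h'.symm)
  have hsa := Real.sqrt_pos.2 ha
  have hsb := Real.sqrt_pos.2 hb'
  have hlog := Real.log_le_sub_one_of_pos (div_pos hsb hsa)
  rw [Real.log_div hsb.ne' hsa.ne', Real.log_sqrt ha.le, Real.log_sqrt hb] at hlog
  have h1 := mul_le_mul_of_nonneg_left hlog ha.le
  have h2 : a * (√b / √a - 1) = √a * √b - a := by
    rw [mul_sub, mul_one]
    congr 1
    field_simp
    rw [Real.sq_sqrt ha.le]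
  rw [h2] at h1
  nlinarith [Real.sq_sqrt ha.le, Real.sq_sqrt hb]

theorem entropy_term_add_le {a b : ℝ≥0∞} (ha : a ≤ 1) (hb : b ≤ 1) (h : b = 0 → a = 0) :
    ENNReal.ofReal (-Real.log a.toReal) * a + a +
        ENNReal.ofReal ((√a.toReal - √b.toReal) ^ 2) ≤
      ENNReal.ofReal (-Real.log b.toReal) * a + b := by
  lift a to ℝ≥0 using ne_top_of_le_ne_top ENNReal.one_ne_top ha
  lift b to ℝ≥0 using ne_top_of_le_ne_top ENNReal.one_ne_top hb
  have ha' : (a : ℝ) ≤ 1 := by exact_mod_cast ha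
  have hb' : (b : ℝ) ≤ 1 := by exact_mod_cast hb
  have hla : 0 ≤ -Real.log a := neg_nonneg.2 (Real.log_nonpos a.2 ha')
  have hlb : 0 ≤ -Real.log b := neg_nonneg.2 (Real.log_nonpos b.2 hb')
  have key := mul_neg_log_add_le a.coe_nonneg b.coe_nonneg
    (fun h0 => by simpa using h (by simpa using h0))
  simp only [ENNReal.coe_toReal]
  rw [← ENNReal.ofReal_coe_nnreal, ← ENNReal.ofReal_coe_nnreal, ← ENNReal.ofReal_mul hla,
    ← ENNReal.ofReal_mul hlb, ← ENNReal.ofReal_add (by positivity) a.coe_nonneg,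
    ← ENNReal.ofReal_add (by positivity) (by positivity), ← ENNReal.ofReal_add (by positivity) b.coe_nonneg]
  exact ENNReal.ofReal_le_ofReal key

theorem entropy_le (ν : PMF G) (c : ℝ≥0) (ρ : G → ℝ≥0) :
    entropy ν ≤ c * mean ν ρ + ∑' g, ENNReal.ofReal (Real.exp (-(c * ρ g))) := by
  rw [entropy, mean, ← ENNReal.tsum_mul_left, ← ENNReal.tsum_add]
  refine ENNReal.tsum_le_tsum fun g => ?_
  have h := entropy_term_add_le (a := ν g) (b := ENNReal.ofReal (Real.exp (-(c * ρ g))))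
    (ν.coe_le_one g) (by simpa using by positivity) (by simp [Real.exp_pos])
  rw [ENNReal.toReal_ofReal (Real.exp_pos _).le, Real.log_exp, neg_neg,
    ENNReal.ofReal_mul (by positivity), ENNReal.ofReal_coe_nnreal, ENNReal.ofReal_coe_nnreal,
    add_assoc, mul_assoc] at h
  exact le_self_add.trans h

/-- The entropy of the convolution is a `μ`-average over `s` of cross-entropies of `ν` against
translates of `conv μ ν`. Gibbs bounds each below by `entropy ν` plus a Hellinger term, of which
only one is kept. -/
theorem entropy_add_le_entropy_conv [Group G] (μ ν : PMF G) (s : G) :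
    entropy ν + μ s * hellingerSq ν (fun y => conv μ ν (s * y)) ≤ entropy (conv μ ν) := by
  have hsum (s : G) : ∑' y, conv μ ν (s * y) = 1 := by
    rw [← (conv μ ν).tsum_coe]
    exact (Equiv.mulLeft s).tsum_eq _
  have key (s : G) : μ s * (entropy ν + 1 + hellingerSq ν (fun y => conv μ ν (s * y))) ≤
      μ s * (∑' y, ENNReal.ofReal (-Real.log (conv μ ν (s * y)).toReal) * ν y + 1) := by
    rcases eq_or_ne (μ s) 0 with hs | hs
    · simp [hs]
    gcongr μ s * ?_
    conv_lhs => rw [← ν.tsum_coe]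
    conv_rhs => rw [← hsum s]
    rw [entropy, hellingerSq, ← ENNReal.tsum_add, ← ENNReal.tsum_add, ← ENNReal.tsum_add]
    refine ENNReal.tsum_le_tsum fun y => entropy_term_add_le (ν.coe_le_one y)
      ((conv μ ν).coe_le_one _) fun h0 => ?_
    -- Absolute continuity: `conv μ ν (s * y) ≥ μ s * ν y` with `μ s ≠ 0`.
    rw [conv_apply, ENNReal.tsum_eq_zero] at h0
    simpa [hs] using h0 s
  have hle := ENNReal.tsum_le_tsum key
  simp only [mul_add, ENNReal.tsum_add, ENNReal.tsum_mul_right, μ.tsum_coe, mul_one, one_mul]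
    at hle
  rw [← tsum_mul_conv μ ν fun x => ENNReal.ofReal (-Real.log (conv μ ν x).toReal), add_right_comm,
    ENNReal.add_le_add_iff_right ENNReal.one_ne_top] at hle
  refine le_trans ?_ hle
  gcongr
  exact ENNReal.le_tsum (f := fun s => μ s * hellingerSq ν (fun y => conv μ ν (s * y))) s

theorem abs_sub_le_sq_sqrt_sub {a b ε : ℝ} (ha : 0 ≤ a) (hb : 0 ≤ b) (hε : 0 < ε) :
    |a - b| ≤ ε⁻¹ * (√a - √b) ^ 2 + ε * (a + b) := by
  have h1 : |a - b| = |√a - √b| * (√a + √b) := by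
    rw [← abs_of_nonneg (add_nonneg (Real.sqrt_nonneg a) (Real.sqrt_nonneg b)), ← abs_mul]
    congr 1
    nlinarith [Real.sq_sqrt ha, Real.sq_sqrt hb]
  rw [h1, ← sq_abs (√a - √b)]
  have h2 : (√a + √b) ^ 2 ≤ 2 * (a + b) := by
    nlinarith [Real.sq_sqrt ha, Real.sq_sqrt hb, sq_nonneg (√a - √b)]
  have h3 : 0 ≤ (2 * ε)⁻¹ * (|√a - √b| - ε * (√a + √b)) ^ 2 := by positivity
  have h4 : (2 * ε)⁻¹ * (|√a - √b| - ε * (√a + √b)) ^ 2 =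
      ε⁻¹ / 2 * |√a - √b| ^ 2 - |√a - √b| * (√a + √b) + ε / 2 * (√a + √b) ^ 2 := by
    field_simp
    ring
  have h5 : 0 ≤ ε⁻¹ * |√a - √b| ^ 2 := by positivity
  nlinarith

/-- The term `2 * ε` is `ε` times the two total masses. -/
theorem tsum_abs_sub_le (a b : PMF G) (e : G ≃ G) {ε : ℝ} (hε : 0 < ε) :
    ∑' y, ENNReal.ofReal |(a y).toReal - (b (e y)).toReal| ≤
      ENNReal.ofReal ε⁻¹ * hellingerSq a (fun y => b (e y)) + ENNReal.ofReal (2 * ε) := by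
  have h2 : ENNReal.ofReal (2 * ε) = ∑' y, ENNReal.ofReal ε * (a y + b (e y)) := by
    rw [ENNReal.tsum_mul_left, ENNReal.tsum_add, a.tsum_coe, e.tsum_eq b, b.tsum_coe, mul_comm,
      ENNReal.ofReal_mul hε.le, one_add_one_eq_two, ENNReal.ofReal_ofNat]
  rw [h2, hellingerSq, ← ENNReal.tsum_mul_left, ← ENNReal.tsum_add]
  refine ENNReal.tsum_le_tsum fun y => ?_
  refine (ENNReal.ofReal_le_ofReal (abs_sub_le_sq_sqrt_sub ENNReal.toReal_nonneg
    ENNReal.toReal_nonneg hε)).trans ?_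
  rw [ENNReal.ofReal_add (by positivity) (by positivity), ENNReal.ofReal_mul (by positivity),
    ENNReal.ofReal_mul hε.le, ENNReal.ofReal_add (by positivity) (by positivity),
    ENNReal.ofReal_toReal (a.apply_ne_top y), ENNReal.ofReal_toReal (b.apply_ne_top _)]

end Entropy

/-! ### Zero drift implies Liouville. -/

section ZeroDrift

variable {G : Type*} [Group G] {μ : PMF G} {ρ : G → ℝ≥0}

theorem IsHarmonic.expect_convPow {u : G → ℝ} {C : ℝ} (hC : ∀ g, |u g| ≤ C)
    (hu : IsHarmonic μ u) (n : ℕ) (g : G) : expect (convPow μ n) (fun x => u (g * x)) = u g := by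
  induction n generalizing g with
  | zero =>
    classical
    rw [expect, tsum_eq_single 1]
    · simp [convPow]
    · intro x hx
      simp [convPow, hx]
  | succ n ih =>
    have h := hasSum_expect_conv μ (convPow μ n)
      (summable_of_bounded (conv μ (convPow μ n)) fun x => hC (g * x))
    rw [convPow_succ_left]
    simp only [← mul_assoc, ih] at h
    exact h.unique (hu g)

theorem ofReal_abs_expect_sub_le (a b : PMF G) {u : G → ℝ} {C : ℝ} (hC : ∀ g, |u g| ≤ C)
    (s : G) :
    ENNReal.ofReal |expect a (fun x => u (s * x)) - expect b u| ≤
      ENNReal.ofReal C * ∑' y, ENNReal.ofReal |(a y).toReal - (b (s * y)).toReal| := by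
  have hs1 := summable_of_bounded a fun x => hC (s * x)
  have hs2 : Summable fun x => u (s * x) * (b (s * x)).toReal :=
    (Equiv.mulLeft s).summable_iff.2 (summable_of_bounded b hC)
  have h3 : expect b u = ∑' x, u (s * x) * (b (s * x)).toReal :=
    ((Equiv.mulLeft s).tsum_eq fun x => u x * (b x).toReal).symm
  rw [h3, expect, ← hs1.tsum_sub hs2, ← Real.enorm_eq_ofReal_abs, ← ENNReal.tsum_mul_left]
  refine enorm_tsum_le_tsum_enorm.trans (ENNReal.tsum_le_tsum fun y => ?_)
  rw [← mul_sub, enorm_mul, Real.enorm_eq_ofReal_abs, Real.enorm_eq_ofReal_abs]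
  gcongr
  exact hC _

theorem IsHarmonic.ofReal_abs_sub_le {u : G → ℝ} {C : ℝ} (hC : ∀ g, |u g| ≤ C)
    (hu : IsHarmonic μ u) (n : ℕ) (g s : G) :
    ENNReal.ofReal |u (g * s) - u g| ≤ ENNReal.ofReal C *
      ∑' y, ENNReal.ofReal |(convPow μ n y).toReal - (convPow μ (n + 1) (s * y)).toReal| := by
  have h := ofReal_abs_expect_sub_le (convPow μ n) (convPow μ (n + 1)) (fun x => hC (g * x)) s
  simp only [← mul_assoc] at h
  rwa [hu.expect_convPow hC, hu.expect_convPow hC] at h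

theorem nat_mul_le_entropy_convPow {s : G} {δ : ℝ≥0∞}
    (hδ : ∀ n, δ ≤ hellingerSq (convPow μ n) (fun y => convPow μ (n + 1) (s * y))) (n : ℕ) :
    n * (μ s * δ) ≤ entropy (convPow μ n) := by
  induction n with
  | zero => simp
  | succ n ih =>
    have h := entropy_add_le_entropy_conv μ (convPow μ n) s
    rw [← convPow_succ_left] at h
    refine le_trans ?_ h
    push_cast
    rw [add_mul, one_mul]
    gcongr
    exact hδ n

/-- Otherwise entropy grows at least linearly, with slope `μ s * δ`, against the sublinear bound
from `entropy_le`. -/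
theorem exists_hellingerSq_lt (hρ : IsWordNorm ρ) (hint : IsIntegrable μ ρ)
    (hdrift : drift μ ρ = 0) {s : G} (hs : μ s ≠ 0) {δ : ℝ≥0∞} (hδ : 0 < δ) :
    ∃ n, hellingerSq (convPow μ n) (fun y => convPow μ (n + 1) (s * y)) < δ := by
  by_contra! hcon
  have hlim := tendsto_driftSeq hρ.isLength hint
  rw [hdrift] at hlim
  obtain ⟨S, hfin, hS, hgen, hSρ⟩ := hρ
  set c : ℝ≥0 := (S.ncard : ℝ≥0) with hc
  set Z : ℝ≥0∞ := ∑' g, ENNReal.ofReal (Real.exp (-(c * ρ g))) with hZ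
  have hZtop : Z ≠ ∞ := by
    have := tsum_exp_neg_card_mul_wordNorm_lt_top hfin hS hgen
    simpa [hZ, hc, hSρ] using this.ne
  have hle : ∀ᶠ n : ℕ in Filter.atTop, μ s * δ ≤ c * driftSeq μ ρ n + Z / n := by
    filter_upwards [Filter.eventually_gt_atTop 0] with n hn
    have h := (nat_mul_le_entropy_convPow hcon n).trans (entropy_le (convPow μ n) c ρ)
    rw [driftSeq, ← mul_div_assoc, ← ENNReal.add_div, ENNReal.le_div_iff_mul_le
      (Or.inl (by exact_mod_cast hn.ne')) (Or.inl (ENNReal.natCast_ne_top n)), mul_comm]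
    exact h
  have ht : Filter.Tendsto (fun n : ℕ => c * driftSeq μ ρ n + Z / n) Filter.atTop (𝓝 0) := by
    have h1 := ENNReal.Tendsto.const_mul (a := (c : ℝ≥0∞)) hlim (Or.inr ENNReal.coe_ne_top)
    have h2 := ENNReal.Tendsto.const_div (a := Z) ENNReal.tendsto_nat_nhds_top (Or.inr hZtop)
    simpa using h1.add h2
  have h0 := ge_of_tendsto ht hle
  exact (mul_ne_zero hs hδ.ne') (le_zero_iff.1 h0)

theorem isLiouville_of_drift_eq_zero (hμ : Subsemigroup.closure μ.support = ⊤)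
    (hρ : IsWordNorm ρ) (hint : IsIntegrable μ ρ) (hdrift : drift μ ρ = 0) : IsLiouville μ := by
  rintro u ⟨C, hC⟩ hu
  have hC0 : 0 ≤ C := (abs_nonneg _).trans (hC 1)
  have hstep (s : G) (hs : s ∈ μ.support) (g : G) : u (g * s) = u g := by
    rw [← sub_eq_zero, ← abs_nonpos_iff]
    have hbound (ε : ℝ) (hε : 0 < ε) : |u (g * s) - u g| ≤ C * (3 * ε) := by
      -- With `δ = ε²` the total variation bound becomes `ε⁻¹ * ε² + 2 * ε = 3 * ε`.
      obtain ⟨n, hn⟩ := exists_hellingerSq_lt hρ hint hdrift ((μ.mem_support_iff s).1 hs)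
        (δ := ENNReal.ofReal (ε ^ 2)) (by simpa using by positivity)
      rw [← ENNReal.ofReal_le_ofReal_iff (by positivity), ENNReal.ofReal_mul hC0]
      refine (hu.ofReal_abs_sub_le hC n g s).trans ?_
      gcongr
      refine (tsum_abs_sub_le (convPow μ n) (convPow μ (n + 1)) (Equiv.mulLeft s) hε).trans ?_
      calc _ ≤ ENNReal.ofReal ε⁻¹ * ENNReal.ofReal (ε ^ 2) + ENNReal.ofReal (2 * ε) := by
            gcongr
            exact hn.le
        _ = _ := by
            rw [← ENNReal.ofReal_mul (by positivity), ← ENNReal.ofReal_add (by positivity)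
              (by positivity)]
            congr 1
            field_simp
            ring
    have ht : Filter.Tendsto (fun ε : ℝ => C * (3 * ε)) (𝓝[>] 0) (𝓝 0) := by
      have : Continuous fun ε : ℝ => C * (3 * ε) := by fun_prop
      simpa using (this.tendsto 0).mono_left nhdsWithin_le_nhds
    exact ge_of_tendsto ht (by filter_upwards [self_mem_nhdsWithin] with ε hε using hbound ε hε)
  have hall (h g : G) : u (g * h) = u g := by
    have hh : h ∈ Subsemigroup.closure μ.support := hμ ▸ Subsemigroup.mem_top h
    induction hh using Subsemigroup.closure_induction generalizing g with
    | mem x hx => exact hstep x hx g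
    | mul x y _ _ hx hy => rw [← mul_assoc, hy, hx]
  exact ⟨u 1, fun g => by simpa using hall g 1⟩

end ZeroDrift

/-! ### Liouville implies zero drift. -/

section Liouville

variable {G : Type*} [Group G] {μ : PMF G} {ρ : G → ℝ≥0}

/-- The Cesàro average of the expectations of `f` along the random walk. -/
noncomputable def cesaro (μ : PMF G) (f : G → ℝ) (N : ℕ) : ℝ :=
  (∑ n ∈ Finset.range N, expect (convPow μ n) f) / N

/-- The limit of the Cesàro averages along a fixed nonprincipal ultrafilter. -/
noncomputable def ultraMean (μ : PMF G) (f : G → ℝ) : ℝ :=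
  Filter.limUnder (Filter.hyperfilter ℕ : Filter ℕ) (cesaro μ f)

theorem abs_cesaro_le (μ : PMF G) {f : G → ℝ} {C : ℝ} (hf : ∀ x, |f x| ≤ C) (N : ℕ) :
    |cesaro μ f N| ≤ C := by
  have hC : 0 ≤ C := (abs_nonneg _).trans (hf 1)
  rw [cesaro, abs_div, Nat.abs_cast]
  refine div_le_of_le_mul₀ (Nat.cast_nonneg N) hC ?_
  refine (Finset.abs_sum_le_sum_abs _ _).trans
    ((Finset.sum_le_sum fun n _ => abs_expect_le (convPow μ n) hf).trans ?_)
  simp [mul_comm]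

theorem tendsto_cesaro (μ : PMF G) {f : G → ℝ} {C : ℝ} (hf : ∀ x, |f x| ≤ C) :
    Filter.Tendsto (cesaro μ f) (Filter.hyperfilter ℕ : Filter ℕ) (𝓝 (ultraMean μ f)) := by
  refine tendsto_nhds_limUnder ?_
  obtain ⟨x, -, hx⟩ := (isCompact_Icc (a := -C) (b := C)).ultrafilter_le_nhds'
    ((Filter.hyperfilter ℕ).map (cesaro μ f))
    (Filter.mem_map.2 (Filter.Eventually.of_forall fun N => abs_le.1 (abs_cesaro_le μ hf N)))
  exact ⟨x, hx⟩

theorem abs_ultraMean_le (μ : PMF G) {f : G → ℝ} {C : ℝ} (hf : ∀ x, |f x| ≤ C) :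
    |ultraMean μ f| ≤ C :=
  le_of_tendsto (tendsto_cesaro μ hf).abs (Filter.Eventually.of_forall (abs_cesaro_le μ hf))

theorem ultraMean_add (μ : PMF G) {f g : G → ℝ} {C D : ℝ} (hf : ∀ x, |f x| ≤ C)
    (hg : ∀ x, |g x| ≤ D) : ultraMean μ (fun x => f x + g x) = ultraMean μ f + ultraMean μ g := by
  have hfg (x : G) : |f x + g x| ≤ C + D := (abs_add_le _ _).trans (add_le_add (hf x) (hg x))
  refine tendsto_nhds_unique (tendsto_cesaro μ hfg) ?_
  refine ((tendsto_cesaro μ hf).add (tendsto_cesaro μ hg)).congr fun N => ?_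
  rw [cesaro, cesaro, cesaro, ← add_div, ← Finset.sum_add_distrib]
  congr 1
  exact Finset.sum_congr rfl fun n _ => (expect_add _ (summable_of_bounded _ hf)
    (summable_of_bounded _ hg)).symm

/-- Averaging the Cesàro means of a family of functions over `μ`. -/
theorem hasSum_cesaro_mul {F : G → G → ℝ} {a : ℕ → ℝ}
    (h : ∀ n, HasSum (fun s => expect (convPow μ n) (F s) * (μ s).toReal) (a n)) (N : ℕ) :
    HasSum (fun s => cesaro μ (F s) N * (μ s).toReal) ((∑ n ∈ Finset.range N, a n) / N) := by
  have := (hasSum_sum (s := Finset.range N) fun n _ => h n).div_const (N : ℝ)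
  refine this.congr_fun fun s => ?_
  rw [cesaro, ← Finset.sum_mul]
  ring

/-- The ultrafilter mean is only finitely additive in general; the summable majorant `B` lets
dominated convergence exchange it with the sum over `s`. -/
theorem hasSum_ultraMean_mul {F : G → G → ℝ} {a : ℕ → ℝ} {B : G → ℝ} {l : ℝ}
    (h : ∀ n, HasSum (fun s => expect (convPow μ n) (F s) * (μ s).toReal) (a n))
    (hB : ∀ s x, |F s x| ≤ B s) (hBs : Summable fun s => B s * (μ s).toReal)
    (hl : Filter.Tendsto (fun N : ℕ => (∑ n ∈ Finset.range N, a n) / N)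
      (Filter.hyperfilter ℕ : Filter ℕ) (𝓝 l)) :
    HasSum (fun s => ultraMean μ (F s) * (μ s).toReal) l := by
  have hdom (f : ℝ) (s : G) (hf : |f| ≤ B s) : ‖f * (μ s).toReal‖ ≤ B s * (μ s).toReal := by
    rw [norm_mul, Real.norm_eq_abs, Real.norm_of_nonneg ENNReal.toReal_nonneg]
    exact mul_le_mul_of_nonneg_right hf ENNReal.toReal_nonneg
  have hsum : Summable fun s => ultraMean μ (F s) * (μ s).toReal :=
    Summable.of_norm_bounded hBs fun s => hdom _ s (abs_ultraMean_le μ (hB s))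
  have ht := tendsto_tsum_of_dominated_convergence (𝓕 := (Filter.hyperfilter ℕ : Filter ℕ)) hBs
    (fun s => (tendsto_cesaro μ (hB s)).mul_const (μ s).toReal)
    (Filter.Eventually.of_forall fun N s => hdom _ s (abs_cesaro_le μ (hB s) N))
  simp only [(hasSum_cesaro_mul h _).tsum_eq] at ht
  rw [tendsto_nhds_unique hl ht]
  exact hsum.hasSum

/-- Averaging over one `μ`-step shifts the time `n` by one, which changes the Cesàro mean by `(a N -
a 0) / N → 0`. -/
theorem isHarmonic_ultraMean (μ : PMF G) {f : G → ℝ} {C : ℝ} (hf : ∀ x, |f x| ≤ C) :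
    IsHarmonic μ fun g => ultraMean μ fun x => f (g * x) := by
  intro g
  set a : ℕ → ℝ := fun n => expect (convPow μ n) fun x => f (g * x) with ha
  have hbd (n : ℕ) : |a n| ≤ C := abs_expect_le _ fun x => hf (g * x)
  refine hasSum_ultraMean_mul (F := fun s x => f (g * s * x)) (a := fun n => a (n + 1))
    (B := fun _ => C) (fun n => ?_) (fun s x => hf _)
    ((hasSum_toReal μ).summable.mul_left C) ?_
  · have h := hasSum_expect_conv μ (convPow μ n) (f := fun x => f (g * x))
      (summable_of_bounded _ fun x => hf (g * x))
    simp only [ha, convPow_succ_left, mul_assoc]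
    exact h
  · have h1 := tendsto_cesaro μ fun x => hf (g * x)
    have h2 : Filter.Tendsto (fun N : ℕ => (a N - a 0) / N)
        (Filter.hyperfilter ℕ : Filter ℕ) (𝓝 0) := by
      refine Filter.Tendsto.mono_left ?_ Nat.hyperfilter_le_atTop
      refine squeeze_zero_norm (a := fun N : ℕ => 2 * C / N) (fun N => ?_)
        (tendsto_const_div_atTop_nhds_zero_nat _)
      rw [norm_div, Real.norm_natCast, Real.norm_eq_abs]
      gcongr
      have := abs_sub (a N) (a 0)
      linarith [hbd N, hbd 0]
    have h3 := h1.add h2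
    rw [add_zero] at h3
    refine h3.congr fun N => ?_
    rw [cesaro, ← add_div]
    congr 1
    have h4 := Finset.sum_range_succ' a N
    rw [Finset.sum_range_succ] at h4
    change ∑ n ∈ Finset.range N, a n + _ = _
    linarith

theorem IsLiouville.ultraMean_mul_left (h : IsLiouville μ) {f : G → ℝ} {C : ℝ}
    (hf : ∀ x, |f x| ≤ C) (g : G) : ultraMean μ (fun x => f (g * x)) = ultraMean μ f := by
  obtain ⟨c, hc⟩ := h _ ⟨C, fun g => abs_ultraMean_le μ fun x => hf (g * x)⟩
    (isHarmonic_ultraMean μ hf)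
  have h1 := hc 1
  simp only [one_mul] at h1
  rw [hc g, h1]

/-- The averaged Busemann cocycle of the length `ρ`. -/
noncomputable def busemann (μ : PMF G) (ρ : G → ℝ≥0) (g : G) : ℝ :=
  ultraMean μ fun x => (ρ (g⁻¹ * x) : ℝ) - ρ x

/-- Insert `ρ (g⁻¹ * x)` and use left-invariance of the mean to remove the translation by `g⁻¹` from
the first difference. -/
theorem IsLiouville.busemann_mul (h : IsLiouville μ) (hρ : IsLength ρ) (g k : G) :
    busemann μ ρ (g * k) = busemann μ ρ k + busemann μ ρ g := by
  rw [busemann, busemann, ← h.ultraMean_mul_left (hρ.abs_sub_le k) g⁻¹, busemann,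
    ← ultraMean_add μ (fun x => hρ.abs_sub_le k (g⁻¹ * x)) (hρ.abs_sub_le g)]
  congr 1
  ext x
  rw [mul_inv_rev, mul_assoc]
  ring

/-- By symmetry `s⁻¹` also has law `μ`, so `s⁻¹ * x` has law `μ^{*(n+1)}`; these increments
telescope in `hasSum_busemann`. -/
theorem hasSum_expect_length_sub (hsymm : IsSymmetric μ) (hρ : IsLength ρ)
    (hint : IsIntegrable μ ρ) (n : ℕ) :
    HasSum (fun s => expect (convPow μ n) (fun x => (ρ (s⁻¹ * x) : ℝ) - ρ x) * (μ s).toReal)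
      ((mean (convPow μ (n + 1)) ρ).toReal - (mean (convPow μ n) ρ).toReal) := by
  have hn := mean_convPow_ne_top hρ hint n
  have hn1 := mean_convPow_ne_top hρ hint (n + 1)
  have h1 : HasSum (fun s => expect (convPow μ n) (fun x => (ρ (s * x) : ℝ)) * (μ s).toReal)
      (mean (convPow μ (n + 1)) ρ).toReal := by
    rw [← expect_eq_mean hn1, convPow_succ_left]
    refine hasSum_expect_conv μ (convPow μ n) (f := fun x => (ρ x : ℝ)) ?_
    rw [← convPow_succ_left]
    exact (hasSum_mean hn1).summable
  have h2 := (Equiv.inv G).hasSum_iff.2 h1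
  have h3 := (hasSum_toReal μ).mul_left (mean (convPow μ n) ρ).toReal
  rw [mul_one] at h3
  refine (h2.sub h3).congr_fun fun s => ?_
  have hs : Summable fun x => (ρ (s⁻¹ * x) : ℝ) * (convPow μ n x).toReal := by
    have := (summable_of_bounded (convPow μ n) (hρ.abs_sub_le s)).add (hasSum_mean hn).summable
    refine this.congr fun x => ?_
    ring
  rw [expect_sub _ hs (hasSum_mean hn).summable, expect_eq_mean hn]
  simp only [Function.comp_apply, Equiv.inv_apply, hsymm s]
  ring

theorem hasSum_busemann (hsymm : IsSymmetric μ) (hρ : IsLength ρ) (hint : IsIntegrable μ ρ) :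
    HasSum (fun s => busemann μ ρ s * (μ s).toReal) (drift μ ρ).toReal := by
  refine hasSum_ultraMean_mul (hasSum_expect_length_sub hsymm hρ hint) hρ.abs_sub_le
    (hasSum_mean hint.ne).summable ?_
  refine Filter.Tendsto.mono_left ?_ Nat.hyperfilter_le_atTop
  refine (tendsto_mean_convPow_div hρ hint).congr fun N => ?_
  rw [Finset.sum_range_sub fun n => (mean (convPow μ n) ρ).toReal, mean_convPow_zero hρ]
  simp

theorem IsLiouville.drift_eq_zero (h : IsLiouville μ) (hsymm : IsSymmetric μ) (hρ : IsLength ρ)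
    (hint : IsIntegrable μ ρ) : drift μ ρ = 0 := by
  have h1 := hasSum_busemann hsymm hρ hint
  have hone : busemann μ ρ 1 = 0 := by simpa using h.busemann_mul hρ 1 1
  have hinv (g : G) : busemann μ ρ g⁻¹ = -busemann μ ρ g := by
    have := h.busemann_mul hρ g⁻¹ g
    rw [inv_mul_cancel, hone] at this
    linarith
  have h2 := (Equiv.inv G).hasSum_iff.2 h1
  have h3 := h1.neg
  have h4 : (fun s => busemann μ ρ s * (μ s).toReal) ∘ Equiv.inv G =
      fun s => -(busemann μ ρ s * (μ s).toReal) := by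
    ext s
    simp [hinv, hsymm s]
  rw [h4] at h2
  have h5 := h2.unique h3
  have h6 : (drift μ ρ).toReal = 0 := by linarith
  exact ((ENNReal.toReal_eq_zero_iff _).1 h6).resolve_right (drift_lt_top hρ hint).ne

end Liouville

end MeasuredGroup

theorem theorem2p1 {G : Type*} [Group G] [Group.FG G] (μ : PMF G)
    (hμ : MeasuredGroup.IsMeasuredGroup μ) (hsymm : MeasuredGroup.IsSymmetric μ)
    (ρ : G → ℝ≥0) (hρ : MeasuredGroup.IsWordNorm ρ) (hint : MeasuredGroup.IsIntegrable μ ρ) :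
    Filter.Tendsto (MeasuredGroup.driftSeq μ ρ) Filter.atTop (𝓝 (MeasuredGroup.drift μ ρ)) ∧
    MeasuredGroup.drift μ ρ < ∞ ∧
    (MeasuredGroup.IsLiouville μ ↔ MeasuredGroup.drift μ ρ = 0) :=
  ⟨MeasuredGroup.tendsto_driftSeq hρ.isLength hint, MeasuredGroup.drift_lt_top hρ.isLength hint,
    fun h => h.drift_eq_zero hsymm hρ.isLength hint,
    fun h => MeasuredGroup.isLiouville_of_drift_eq_zero hμ.generates hρ hint h⟩
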